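/- Let $n,m,s,k$ be positive integers, let $\alpha$ be a real number with $k-1<\alpha\le k$, and let $A\in\mathbb R^{n\times n}$, $B\in\mathbb R^{n\times m}$, $C\in\mathbb R^{s\times n}$. Consider the Caputo fractional differential system of order $\alpha$ $$({}^{C}D^{\alpha}_{0+}x)(t)=Ax(t)+Bu(t),\qquad y(t)=Cx(t),\qquad t\ge 0,$$ where $u:[0,\infty)\to\mathbb R^m$ is bounded and piecewise continuous (an admissible control). Here $${}^{C}D^{\alpha}_{0+}x=\frac{d^k}{dt^k}\,I^{k-\alpha}\Big(x-\sum_{j=0}^{k-1}\frac{t^j}{j!}x^{(j)}(0)\Big),\qquad (I^{\beta}f)(t)=\frac1{\Gamma(\beta)}\int_0^t(t-\tau)^{\beta-1}f(\tau)\,d\tau\ (\beta>0),\qquad I^0f=f,$$ and a trajectory is a function $x:[0,\infty)\to\mathbb R^n$ of class $C^{k-1}$ that satisfies the equation at every point of continuity of $u$. For $T>0$, the system is observable in $[0,T]$ if, for every admissible control $u$, any two trajectories $x,\tilde x$ with control $u$ such that $Cx(t)=C\tilde x(t)$ for all $t\in[0,T]$ satisfy $x^{(j)}(0)=\tilde x^{(j)}(0)$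 for $j=0,\dots,k-1$; it is observable if it is observable in $[0,T]$ for some $T>0$. Let $\mu$ be the degree of the minimal polynomial of $A$, let $\sigma(A)\subset\mathbb C$ be the spectrum of $A$, and put $$\Phi_{\alpha j}(t)=\sum_{\ell=0}^{\infty}\frac{t^{\alpha\ell}}{\Gamma(\alpha\ell+j+1)}A^{\ell},\qquad \Psi_\alpha(t)=\big[\Phi_{\alpha 0}(t),\ t\,\Phi_{\alpha 1}(t),\ \dots,\ t^{k-1}\Phi_{\alpha,k-1}(t)\big]\in\mathbb R^{n\times kn}.$$ Then the following are equivalent: 0. the system is observable; 0'. the system is observable in $[0,T]$ for every $T>0$; 1. $\operatorname{rank}\big[C^T,\ A^TC^T,\ \dots,\ (A^T)^{\mu-1}C^T\big]=n$; 2. $\operatorname{rank}\big[\lambda I_n-A^T,\ C^T\big]=n$ for every $\lambda\in\sigma(A)$; 3. $\int_0^T\Psi_\alpha(\tau)^TC^TC\,\Psi_\alpha(\tau)\,d\tau$ is positive definite for every $T>0$; 3'. $\int_0^T\Psi_\alpha(\tau)^TC^TC\,\Psi_\alpha(\tau)\,d\tau$ is positive definite for some $T>0$. -/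

import Mathlib

open Set Filter Topology MeasureTheory

namespace FractionalSystem

noncomputable section

/-- Riemann-Liouville fractional integral of order `β ≥ 0` with base point `0`:
`(I^β f)(t) = (1 / Γ(β)) ∫₀ᵗ (t - τ)^(β - 1) f(τ) dτ` for `β > 0`, and `I^0 f = f`. -/
def rlIntegral {E : Type*} [NormedAddCommGroup E] [NormedSpace ℝ E]
    (β : ℝ) (f : ℝ → E) (t : ℝ) : E :=
  if β = 0 then f t
  else (Real.Gamma β)⁻¹ • ∫ τ in (0 : ℝ)..t, (t - τ) ^ (β - 1) • f τ

/-- The initial value `x^(j)(0)`; the derivatives at `0` are one-sided (from the right). -/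
def initialValue {E : Type*} [NormedAddCommGroup E] [NormedSpace ℝ E]
    (x : ℝ → E) (j : ℕ) : E :=
  iteratedDerivWithin j x (Ici 0) 0

/-- The function `I^(k - α) (x - ∑_{j < k} x^(j)(0) t^j / j!)`; its `k`-th derivative is the
Caputo derivative of `x` of order `α`, where `k - 1 < α ≤ k`. -/
def caputoPrimitive {E : Type*} [NormedAddCommGroup E] [NormedSpace ℝ E]
    (α : ℝ) (k : ℕ) (x : ℝ → E) : ℝ → E :=
  rlIntegral ((k : ℝ) - α)
    (fun t => x t - ∑ j ∈ Finset.range k, (t ^ j / (j.factorial : ℝ)) • initialValue x j)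

/-- The Caputo derivative of `x : [0, ∞) → E` of order `α`, `k - 1 < α ≤ k`, exists at `t` and
equals `v`. It is the `k`-th derivative of `I^(k - α) (x - ∑_{j < k} x^(j)(0) t^j / j!)`
(for `α = k` this is the ordinary `k`-th derivative of `x`). -/
def HasCaputoDerivAt {E : Type*} [NormedAddCommGroup E] [NormedSpace ℝ E]
    (α : ℝ) (k : ℕ) (x : ℝ → E) (v : E) (t : ℝ) : Prop :=
  ContDiffOn ℝ ((k - 1 : ℕ) : WithTop ℕ∞) (caputoPrimitive α k x) (Ici 0) ∧
    HasDerivWithinAt (iteratedDerivWithin (k - 1) (caputoPrimitive α k x) (Ici 0)) v (Ici 0) t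

/-- Admissible controls: bounded piecewise continuous functions on `[0, ∞)`, that is, with
finitely many discontinuities in every bounded interval and with finite one-sided limits. -/
structure IsAdmissibleControl {m : ℕ} (u : ℝ → Fin m → ℝ) : Prop where
  bounded : ∃ M : ℝ, ∀ t, 0 ≤ t → ‖u t‖ ≤ M
  finite_discontinuities :
    ∀ T : ℝ, {t | t ∈ Icc 0 T ∧ ¬ ContinuousWithinAt u (Ici 0) t}.Finite
  left_limit : ∀ t, 0 < t → ∃ l, Tendsto u (𝓝[<] t) (𝓝 l)
  right_limit : ∀ t, 0 ≤ t → ∃ l, Tendsto u (𝓝[>] t) (𝓝 l)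

/-- `x` is a state trajectory on `[0, ∞)`, with control `u`, of the Caputo fractional system
`D^α x = A x + B u` of order `α`, `k - 1 < α ≤ k`: it is of class `C^(k-1)` and satisfies the
equation wherever `u` is continuous. -/
structure IsTrajectory {n m : ℕ} (α : ℝ) (k : ℕ)
    (A : Matrix (Fin n) (Fin n) ℝ) (B : Matrix (Fin n) (Fin m) ℝ)
    (u : ℝ → Fin m → ℝ) (x : ℝ → Fin n → ℝ) : Prop where
  contDiffOn : ContDiffOn ℝ ((k - 1 : ℕ) : WithTop ℕ∞) x (Ici 0)
  equation : ∀ t, 0 ≤ t → ContinuousWithinAt u (Ici 0) t →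
    HasCaputoDerivAt α k x (A.mulVec (x t) + B.mulVec (u t)) t

/-- Observability in `[0, T]` of the Caputo fractional system `D^α x = A x + B u`, `y = C x`:
under every (known) admissible control, the output on `[0, T]` determines the initial conditions
`x^(j)(0)`, `0 ≤ j ≤ k - 1`, uniquely. -/
def ObservableOn {n m s : ℕ} (α : ℝ) (k : ℕ) (A : Matrix (Fin n) (Fin n) ℝ)
    (B : Matrix (Fin n) (Fin m) ℝ) (C : Matrix (Fin s) (Fin n) ℝ) (T : ℝ) : Prop :=
  ∀ u : ℝ → Fin m → ℝ, IsAdmissibleControl u →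
    ∀ x x' : ℝ → Fin n → ℝ, IsTrajectory α k A B u x → IsTrajectory α k A B u x' →
      (∀ t ∈ Icc 0 T, C.mulVec (x t) = C.mulVec (x' t)) →
      ∀ j < k, initialValue x j = initialValue x' j

/-- Observability: observability in some interval `[0, T]` of nonzero measure. -/
def Observable {n m s : ℕ} (α : ℝ) (k : ℕ) (A : Matrix (Fin n) (Fin n) ℝ)
    (B : Matrix (Fin n) (Fin m) ℝ) (C : Matrix (Fin s) (Fin n) ℝ) : Prop :=
  ∃ T : ℝ, 0 < T ∧ ObservableOn α k A B C T

/-- The block matrix `[Cᵀ, Aᵀ Cᵀ, …, (Aᵀ)^(μ-1) Cᵀ]`, with `μ` the degree of the minimal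
polynomial of `A`. -/
def obsMatrix {n s : ℕ} (A : Matrix (Fin n) (Fin n) ℝ) (C : Matrix (Fin s) (Fin n) ℝ) :
    Matrix (Fin n) (Fin (minpoly ℝ A).natDegree × Fin s) ℝ :=
  Matrix.of fun i p => (A.transpose ^ (p.1 : ℕ) * C.transpose) i p.2

/-- The complex block matrix `[lam I - Aᵀ, Cᵀ]`. -/
def pbhMatrix {n s : ℕ} (A : Matrix (Fin n) (Fin n) ℝ) (C : Matrix (Fin s) (Fin n) ℝ)
    (lam : ℂ) : Matrix (Fin n) (Fin n ⊕ Fin s) ℂ :=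
  Matrix.fromCols (lam • (1 : Matrix (Fin n) (Fin n) ℂ) - (A.map Complex.ofReal).transpose)
    (C.map Complex.ofReal).transpose

/-- The matrix function `Φ_{αj}(t) = ∑_ℓ A^ℓ t^(αℓ) / Γ(αℓ + j + 1)`. -/
def Phi {n : ℕ} (α : ℝ) (A : Matrix (Fin n) (Fin n) ℝ) (j : ℕ) (t : ℝ) :
    Matrix (Fin n) (Fin n) ℝ :=
  ∑' l : ℕ, (t ^ (α * (l : ℝ)) / Real.Gamma (α * (l : ℝ) + (j : ℝ) + 1)) • A ^ l

/-- The block matrix `Ψ_α(t) = [Φ_{α0}(t), t Φ_{α1}(t), …, t^(k-1) Φ_{α,k-1}(t)]`. -/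
def Psi {n : ℕ} (α : ℝ) (k : ℕ) (A : Matrix (Fin n) (Fin n) ℝ) (t : ℝ) :
    Matrix (Fin n) (Fin k × Fin n) ℝ :=
  Matrix.of fun i p => (t ^ (p.1 : ℕ) • Phi α A (p.1 : ℕ) t) i p.2

/-- The observability Gramian `∫₀ᵀ Ψ_α(τ)ᵀ Cᵀ C Ψ_α(τ) dτ`, integrated entrywise. -/
def obsGramian {n s : ℕ} (α : ℝ) (k : ℕ) (A : Matrix (Fin n) (Fin n) ℝ)
    (C : Matrix (Fin s) (Fin n) ℝ) (T : ℝ) : Matrix (Fin k × Fin n) (Fin k × Fin n) ℝ :=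
  Matrix.of fun p q => ∫ τ in (0 : ℝ)..T,
    ((Psi α k A τ).transpose * C.transpose * C * Psi α k A τ) p q

end

end FractionalSystem

/-!
Call a state `z` unobservable if `C A ^ l z = 0` for all `l`. Since every power of `A` is a linear
combination of the powers below the degree of the minimal polynomial, Kalman's rank condition says
that `0` is the only unobservable state (`obsMatrix_rank_iff`). The unobservable states form an
`A`-invariant subspace, so over `ℂ` a nonzero one yields an eigenvector of `A` in the kernel of `C`;
this is the Popov–Belevitch–Hautus test (`obsMatrix_rank_iff_pbhMatrix_rank`).

Kalman's condition implies observability on every `[0, T]` without solving the equation. The Caputo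
derivative commutes with linear maps and its values on `[0, T)` are determined by the function on
`[0, T]`. Hence, if `D x = D x'` on `[0, T]` for two trajectories with the same control, then
`D (A x + B u) = D (A x' + B u)` off the finitely many discontinuities of `u`, so `D A x = D A x'`
on `[0, T]` by continuity (`eqOn_mul_mulVec_of_eqOn`). Starting from `D = C`, this gives
`C A ^ l x = C A ^ l x'` for all `l`, so `x = x'` on `[0, T]`, and the initial values agree.

For the Gramian and the converse, explicit trajectories are needed. Fractional integration of order
`β` of `∑ l, t ^ (α l + b) / Γ(α l + b + 1) • A ^ l v` replaces `b` by `b + β`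
(`rlIntegral_mittagLeffler`, from Euler's beta integral). It follows that `Ψ(t) c` is, for every
`c`, a trajectory with zero control whose initial values are the blocks of `c`
(`isTrajectory_freeState`, `initialValue_freeState`, `Psi_mulVec`). The quadratic form of the
Gramian at `c` is the integral of `‖C Ψ(t) c‖²`, so observability on `[0, T]` makes the Gramian
positive definite (`posDef_obsGramian_of_observableOn`), while an unobservable `z` makes it
degenerate at `c = (z, 0, …, 0)` (`kalman_of_posDef_obsGramian`).
-/

namespace FractionalSystem

/-! ### The Kalman and Popov–Belevitch–Hautus rank conditions -/

lemma rank_eq_iff_vecMul_injective {K ι : Type*} [Field K] [Fintype ι] {n : ℕ}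
    (M : Matrix (Fin n) ι K) : M.rank = n ↔ ∀ z : Fin n → K, M.vecMul z = 0 → z = 0 := by
  have h : M.rank = n ↔ LinearIndependent K M.row := by
    rw [linearIndependent_iff_card_eq_finrank_span, M.rank_eq_finrank_span_row, Fintype.card_fin,
      eq_comm]
    rfl
  rw [h, ← Matrix.vecMul_injective_iff]
  exact injective_iff_map_eq_zero M.vecMulLinear

/-- Powers of `A` beyond the degree of the minimal polynomial add nothing to the kernel of the
outputs `C A ^ p`. -/
lemma mul_pow_mulVec_eq_zero {n s : ℕ} {A : Matrix (Fin n) (Fin n) ℝ}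
    {C : Matrix (Fin s) (Fin n) ℝ} {z : Fin n → ℝ}
    (h : ∀ p < (minpoly ℝ A).natDegree, (C * A ^ p).mulVec z = 0) (l : ℕ) :
    (C * A ^ l).mulVec z = 0 := by
  have hm : (minpoly ℝ A).Monic := minpoly.monic (Matrix.isIntegral A)
  have hA : A ^ l = Polynomial.aeval A ((Polynomial.X ^ l : Polynomial ℝ) %ₘ minpoly ℝ A) := by
    rw [Polynomial.aeval_modByMonic_eq_self_of_root (minpoly.aeval ℝ A)]
    simp
  rw [hA, Polynomial.aeval_def, Polynomial.eval₂_eq_sum, Polynomial.sum_def, Matrix.mul_sum,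
    Matrix.sum_mulVec]
  refine Finset.sum_eq_zero fun p hp => ?_
  have hp' : p < (minpoly ℝ A).natDegree := by
    have h1 := (Polynomial.le_degree_of_mem_supp p hp).trans_lt
      (Polynomial.degree_modByMonic_lt (Polynomial.X ^ l) hm)
    rw [Polynomial.degree_eq_natDegree hm.ne_zero] at h1
    exact_mod_cast h1
  rw [← Algebra.smul_def, Matrix.mul_smul, Matrix.smul_mulVec, h p hp', smul_zero]

/-- Kalman's condition: no nonzero state is invisible to all the outputs `C A ^ l`. -/
lemma obsMatrix_rank_iff {n s : ℕ} (A : Matrix (Fin n) (Fin n) ℝ)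
    (C : Matrix (Fin s) (Fin n) ℝ) :
    (obsMatrix A C).rank = n ↔ ∀ z : Fin n → ℝ, (∀ l, (C * A ^ l).mulVec z = 0) → z = 0 := by
  have key (z : Fin n → ℝ) (p : Fin (minpoly ℝ A).natDegree) (i : Fin s) :
      (obsMatrix A C).vecMul z (p, i) = (C * A ^ (p : ℕ)).mulVec z i := by
    rw [← Matrix.vecMul_transpose, Matrix.transpose_mul, Matrix.transpose_pow]
    rfl
  rw [rank_eq_iff_vecMul_injective]
  refine forall_congr' fun z => imp_congr_left ⟨fun h => mul_pow_mulVec_eq_zero fun p hp => ?_,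
    fun h => ?_⟩
  · ext i
    rw [← key z ⟨p, hp⟩ i, h]
    rfl
  · ext ⟨p, i⟩
    rw [key, h]
    rfl

lemma pbhMatrix_rank_iff {n s : ℕ} (A : Matrix (Fin n) (Fin n) ℝ)
    (C : Matrix (Fin s) (Fin n) ℝ) (lam : ℂ) :
    (pbhMatrix A C lam).rank = n ↔ ∀ w : Fin n → ℂ,
      (A.map Complex.ofReal).mulVec w = lam • w → (C.map Complex.ofReal).mulVec w = 0 →
        w = 0 := by
  rw [rank_eq_iff_vecMul_injective]
  refine forall_congr' fun w => ?_
  rw [← and_imp]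
  refine imp_congr_left ?_
  rw [pbhMatrix, Matrix.vecMul_fromCols, Matrix.vecMul_sub, Matrix.vecMul_transpose,
    Matrix.vecMul_transpose, Matrix.vecMul_smul, Matrix.vecMul_one]
  constructor
  · intro h
    have h1 (i) := congrFun h (Sum.inl i)
    have h2 (i) := congrFun h (Sum.inr i)
    exact ⟨funext fun i => (sub_eq_zero.1 (h1 i)).symm, funext h2⟩
  · rintro ⟨h1, h2⟩
    rw [h1, h2, sub_self]
    ext i
    cases i <;> rfl

/-- The real and imaginary parts of `M w`, for a real matrix `M`. -/
lemma re_im_mulVec_map_ofReal {n s : ℕ} (M : Matrix (Fin s) (Fin n) ℝ) (w : Fin n → ℂ)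
    (i : Fin s) :
    ((M.map Complex.ofReal).mulVec w i).re = M.mulVec (fun j => (w j).re) i ∧
      ((M.map Complex.ofReal).mulVec w i).im = M.mulVec (fun j => (w j).im) i := by
  simp [Matrix.mulVec, dotProduct]

lemma map_ofReal_mul_pow {n s : ℕ} (A : Matrix (Fin n) (Fin n) ℝ)
    (C : Matrix (Fin s) (Fin n) ℝ) (l : ℕ) :
    (C * A ^ l).map Complex.ofReal = C.map Complex.ofReal * A.map Complex.ofReal ^ l := by
  have h := Matrix.map_mul (L := C) (M := A ^ l) (f := Complex.ofRealHom)
  have h' := Matrix.map_pow A Complex.ofRealHom l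
  rw [h'] at h
  exact h

/-- Equivalence of Kalman's condition and the Popov–Belevitch–Hautus test: the complexified
unobservable subspace is invariant under `A`, so if it is nonzero it contains an eigenvector. -/
lemma obsMatrix_rank_iff_pbhMatrix_rank {n s : ℕ} (A : Matrix (Fin n) (Fin n) ℝ)
    (C : Matrix (Fin s) (Fin n) ℝ) :
    (obsMatrix A C).rank = n ↔
      ∀ lam ∈ spectrum ℂ (A.map Complex.ofReal), (pbhMatrix A C lam).rank = n := by
  rw [obsMatrix_rank_iff]
  simp_rw [pbhMatrix_rank_iff]
  set Ac : Matrix (Fin n) (Fin n) ℂ := A.map Complex.ofReal with hAc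
  set Cc : Matrix (Fin s) (Fin n) ℂ := C.map Complex.ofReal with hCc
  constructor
  · intro h lam _ w hw hCw
    have hpow (l : ℕ) : (Ac ^ l).mulVec w = lam ^ l • w := by
      induction l with
      | zero => simp
      | succ l ih => rw [pow_succ, ← Matrix.mulVec_mulVec, hw, Matrix.mulVec_smul, ih, smul_smul,
          pow_succ, mul_comm]
    have hz (l : ℕ) : ((C * A ^ l).map Complex.ofReal).mulVec w = 0 := by
      rw [map_ofReal_mul_pow, ← Matrix.mulVec_mulVec, hpow, Matrix.mulVec_smul, hCw, smul_zero]
    have hre := h (fun j => (w j).re) fun l => funext fun i => by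
      rw [← (re_im_mulVec_map_ofReal _ w i).1, hz]; rfl
    have him := h (fun j => (w j).im) fun l => funext fun i => by
      rw [← (re_im_mulVec_map_ofReal _ w i).2, hz]; rfl
    exact funext fun j => Complex.ext (congrFun hre j) (congrFun him j)
  · intro h z hz
    by_contra hz0
    let f : Module.End ℂ (Fin n → ℂ) := Matrix.toLin' Ac
    let U : Submodule ℂ (Fin n → ℂ) := ⨅ l : ℕ, LinearMap.ker (Matrix.toLin' (Cc * Ac ^ l))
    have hU (w : Fin n → ℂ) : w ∈ U ↔ ∀ l, (Cc * Ac ^ l).mulVec w = 0 := by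
      simp only [U, Submodule.mem_iInf, LinearMap.mem_ker, Matrix.toLin'_apply]
    have hinv : ∀ w ∈ U, f w ∈ U := by
      intro w hw
      rw [hU] at hw ⊢
      intro l
      have := hw (l + 1)
      rwa [pow_succ, ← Matrix.mul_assoc, ← Matrix.mulVec_mulVec] at this
    have hzU : (fun j => (z j : ℂ)) ∈ U := by
      rw [hU]
      intro l
      rw [hAc, hCc, ← map_ofReal_mul_pow]
      ext i
      have h1 := re_im_mulVec_map_ofReal (C * A ^ l) (fun j => (z j : ℂ)) i
      refine Complex.ext (h1.1.trans ?_) (h1.2.trans ?_)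
      · exact congrFun (hz l) i
      · exact congrFun (Matrix.mulVec_zero (C * A ^ l)) i
    have : Nontrivial U := by
      refine ⟨⟨⟨_, hzU⟩, 0, fun h0 => hz0 ?_⟩⟩
      ext j
      have := congrFun (congrArg Subtype.val h0) j
      simpa using this
    obtain ⟨lam, hlam⟩ := Module.End.exists_eigenvalue (f.restrict hinv)
    obtain ⟨w, hw⟩ := hlam.exists_hasEigenvector
    have hfw : f w = lam • (w : Fin n → ℂ) := congrArg Subtype.val hw.apply_eq_smul
    have hw0 : (w : Fin n → ℂ) ≠ 0 := fun h0 => hw.2 (Subtype.ext h0)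
    have hev : f.HasEigenvalue lam :=
      Module.End.hasEigenvalue_of_hasEigenvector
        (Module.End.hasEigenvector_iff.2 ⟨Module.End.mem_eigenspace_iff.2 hfw, hw0⟩)
    have hsp : lam ∈ spectrum ℂ Ac := by
      rw [← Matrix.spectrum_toLin']
      exact hev.mem_spectrum
    refine hw0 (h lam hsp w hfw ?_)
    simpa using (hU w).1 w.2 0

/-! ### The Caputo derivative is local and commutes with linear maps -/

section Caputo

variable {E F : Type*} [NormedAddCommGroup E] [NormedSpace ℝ E] [NormedAddCommGroup F]
  [NormedSpace ℝ F]

lemma iteratedDerivWithin_clm_comp {f : ℝ → E} {s : Set ℝ} {N i : ℕ} (L : E →L[ℝ] F)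
    (hf : ContDiffOn ℝ N f s) (hs : UniqueDiffOn ℝ s) (hi : i ≤ N) {t : ℝ} (ht : t ∈ s) :
    iteratedDerivWithin i (fun t => L (f t)) s t = L (iteratedDerivWithin i f s t) := by
  have := L.iteratedFDerivWithin_comp_left (hf t ht) hs ht (i := i) (by exact_mod_cast hi)
  rw [iteratedDerivWithin, iteratedDerivWithin]
  exact congrArg (fun m => m fun _ => (1 : ℝ)) this

lemma eventuallyEq_iteratedDerivWithin {f g : ℝ → E} {s : Set ℝ} {t : ℝ}
    (h : f =ᶠ[𝓝[s] t] g) (i : ℕ) :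
    iteratedDerivWithin i f s =ᶠ[𝓝[s] t] iteratedDerivWithin i g s := by
  filter_upwards [h.iteratedFDerivWithin ℝ i] with τ hτ
  rw [iteratedDerivWithin, iteratedDerivWithin, hτ]

/-- Points of `[0, T)` have a neighbourhood in `[0, ∞)` contained in `[0, T]`. -/
lemma eventuallyEq_of_eqOn_Icc {X : Type*} {f g : ℝ → X} {T t : ℝ} (h : EqOn f g (Icc 0 T))
    (ht : t < T) :
    f =ᶠ[𝓝[Ici 0] t] g := by
  filter_upwards [self_mem_nhdsWithin, mem_nhdsWithin_of_mem_nhds (Iio_mem_nhds ht)] with τ h0 h1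
  exact h ⟨h0, h1.le⟩

lemma initialValue_congr {x y : ℝ → E} {T : ℝ} (hT : 0 < T) (h : EqOn x y (Icc 0 T)) (j : ℕ) :
    initialValue x j = initialValue y j :=
  (eventuallyEq_iteratedDerivWithin (eventuallyEq_of_eqOn_Icc h hT) j).self_of_nhdsWithin
    self_mem_Ici

lemma rlIntegral_congr {β T : ℝ} {f g : ℝ → E} (h : EqOn f g (Icc 0 T)) :
    EqOn (rlIntegral β f) (rlIntegral β g) (Icc 0 T) := by
  intro t ht
  unfold rlIntegral
  rw [h ht, intervalIntegral.integral_congr (g := fun τ => (t - τ) ^ (β - 1) • g τ)]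
  intro τ hτ
  rw [uIcc_of_le ht.1] at hτ
  simp only [h ⟨hτ.1, hτ.2.trans ht.2⟩]

lemma caputoPrimitive_congr {α T : ℝ} {k : ℕ} {x y : ℝ → E} (hT : 0 < T)
    (h : EqOn x y (Icc 0 T)) :
    EqOn (caputoPrimitive α k x) (caputoPrimitive α k y) (Icc 0 T) :=
  rlIntegral_congr fun t ht => by simp only [h ht, initialValue_congr hT h]

/-- The Caputo derivative at a point of `[0, T)` depends only on the restriction to `[0, T]`. -/
lemma HasCaputoDerivAt.eq_of_eqOn {α T t : ℝ} {k : ℕ} {x y : ℝ → E} {v w : E}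
    (hx : HasCaputoDerivAt α k x v t) (hy : HasCaputoDerivAt α k y w t) (h0 : 0 ≤ t) (hT : t < T)
    (h : EqOn x y (Icc 0 T)) : v = w := by
  have h1 := eventuallyEq_iteratedDerivWithin
    (eventuallyEq_of_eqOn_Icc (caputoPrimitive_congr (α := α) (k := k) (h0.trans_lt hT) h) hT)
    (k - 1)
  have h2 := hy.2.congr_of_eventuallyEq h1 (h1.self_of_nhdsWithin h0)
  exact (uniqueDiffOn_Ici (0 : ℝ) t h0).eq_deriv _ hx.2 h2

lemma intervalIntegrable_rpow_sub {β t : ℝ} (hβ : 0 < β) :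
    IntervalIntegrable (fun τ : ℝ => (t - τ) ^ (β - 1)) volume 0 t := by
  have := (intervalIntegral.intervalIntegrable_rpow' (a := t) (b := 0) (r := β - 1)
    (by linarith)).comp_sub_left t
  simpa using this

lemma intervalIntegrable_rpow_sub_smul {β t : ℝ} (hβ : 0 < β) (ht : 0 ≤ t) {f : ℝ → E}
    (hf : ContinuousOn f (Ici 0)) :
    IntervalIntegrable (fun τ => (t - τ) ^ (β - 1) • f τ) volume 0 t := by
  refine (intervalIntegrable_rpow_sub hβ).smul_continuousOn (hf.mono ?_)
  rw [uIcc_of_le ht]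
  exact Icc_subset_Ici_self

lemma rlIntegral_clm_comp [CompleteSpace E] [CompleteSpace F] (L : E →L[ℝ] F) {β t : ℝ}
    (hβ : 0 ≤ β) (ht : 0 ≤ t) {f : ℝ → E} (hf : ContinuousOn f (Ici 0)) :
    rlIntegral β (fun τ => L (f τ)) t = L (rlIntegral β f t) := by
  unfold rlIntegral
  split_ifs with h
  · rfl
  · rw [L.map_smul, ← L.intervalIntegral_comp_comm
      (intervalIntegrable_rpow_sub_smul (hβ.lt_of_ne' h) ht hf)]
    simp

lemma caputoPrimitive_clm_comp [CompleteSpace E] [CompleteSpace F] (L : E →L[ℝ] F) {α : ℝ}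
    {k : ℕ} (hα : α ≤ k) {x : ℝ → E} (hx : ContDiffOn ℝ ((k - 1 : ℕ) : WithTop ℕ∞) x (Ici 0)) :
    EqOn (caputoPrimitive α k (fun τ => L (x τ))) (fun t => L (caputoPrimitive α k x t))
      (Ici 0) := by
  intro t ht
  have hi : ∀ j ∈ Finset.range k, initialValue (fun τ => L (x τ)) j = L (initialValue x j) :=
    fun j hj => iteratedDerivWithin_clm_comp L hx (uniqueDiffOn_Ici 0)
      (Nat.le_sub_one_of_lt (Finset.mem_range.1 hj)) self_mem_Ici
  have hw : ContinuousOn (fun t => x t -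
      ∑ j ∈ Finset.range k, (t ^ j / (j.factorial : ℝ)) • initialValue x j) (Ici 0) :=
    hx.continuousOn.sub (Continuous.continuousOn (by fun_prop))
  simp only [caputoPrimitive]
  rw [← rlIntegral_clm_comp L (sub_nonneg.2 hα) ht hw]
  congr 1
  ext τ
  rw [map_sub, map_sum]
  congr 1
  exact Finset.sum_congr rfl fun j hj => by rw [hi j hj, L.map_smul]

lemma HasCaputoDerivAt.clm_comp [CompleteSpace E] [CompleteSpace F] (L : E →L[ℝ] F) {α t : ℝ}
    {k : ℕ} (hα : α ≤ k) {x : ℝ → E} {v : E}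
    (hx : ContDiffOn ℝ ((k - 1 : ℕ) : WithTop ℕ∞) x (Ici 0)) (ht : 0 ≤ t)
    (h : HasCaputoDerivAt α k x v t) : HasCaputoDerivAt α k (fun τ => L (x τ)) (L v) t := by
  have h1 := caputoPrimitive_clm_comp L hα hx
  have h2 : EqOn (iteratedDerivWithin (k - 1) (caputoPrimitive α k (fun τ => L (x τ))) (Ici 0))
      (fun t => L (iteratedDerivWithin (k - 1) (caputoPrimitive α k x) (Ici 0) t)) (Ici 0) :=
    fun τ hτ => (iteratedDerivWithin_congr h1 hτ).trans
      (iteratedDerivWithin_clm_comp L h.1 (uniqueDiffOn_Ici 0) le_rfl hτ)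
  exact ⟨(L.contDiff.comp_contDiffOn h.1).congr h1,
    (L.hasFDerivAt.comp_hasDerivWithinAt t h.2).congr h2 (h2 ht)⟩

end Caputo

/-! ### Kalman's condition implies observability -/

/-- If the outputs `D x` and `D x'` agree on `[0, T]`, so do `D A x` and `D A x'`: the Caputo
derivatives of `D x` and `D x'` agree, and the contributions of the control cancel. -/
lemma eqOn_mul_mulVec_of_eqOn {n m s k : ℕ} {α T : ℝ} (hα : α ≤ k) (hT : 0 < T)
    {A : Matrix (Fin n) (Fin n) ℝ} {B : Matrix (Fin n) (Fin m) ℝ} {D : Matrix (Fin s) (Fin n) ℝ}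
    {u : ℝ → Fin m → ℝ} (hu : IsAdmissibleControl u) {x x' : ℝ → Fin n → ℝ}
    (hx : IsTrajectory α k A B u x) (hx' : IsTrajectory α k A B u x')
    (h : EqOn (fun t => D.mulVec (x t)) (fun t => D.mulVec (x' t)) (Icc 0 T)) :
    EqOn (fun t => (D * A).mulVec (x t)) (fun t => (D * A).mulVec (x' t)) (Icc 0 T) := by
  set S : Set ℝ := {t | t ∈ Icc 0 T ∧ ¬ ContinuousWithinAt u (Ici 0) t} with hS
  have hfin : S.Finite := hu.finite_discontinuities T
  have hcont {y : ℝ → Fin n → ℝ} (hy : IsTrajectory α k A B u y) :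
      ContinuousOn (fun t => (D * A).mulVec (y t)) (Icc 0 T) :=
    (LinearMap.continuous_of_finiteDimensional (D * A).mulVecLin).comp_continuousOn
      (hy.contDiffOn.continuousOn.mono Icc_subset_Ici_self)
  have hsub : Icc 0 T ⊆ closure (Ioo 0 T ∩ Sᶜ) := by
    rw [← closure_Ioo hT.ne]
    exact closure_minimal
      ((hfin.countable.dense_compl ℝ).open_subset_closure_inter isOpen_Ioo) isClosed_closure
  refine EqOn.of_subset_closure ?_ (hcont hx) (hcont hx')
    (inter_subset_left.trans Ioo_subset_Icc_self) hsub
  rintro t ⟨ht, htS⟩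
  have hut : ContinuousWithinAt u (Ici 0) t := by
    by_contra hc
    exact htS ⟨Ioo_subset_Icc_self ht, hc⟩
  let L : (Fin n → ℝ) →L[ℝ] (Fin s → ℝ) := LinearMap.toContinuousLinearMap D.mulVecLin
  have h1 := (hx.equation t ht.1.le hut).clm_comp L hα hx.contDiffOn ht.1.le
  have h2 := (hx'.equation t ht.1.le hut).clm_comp L hα hx'.contDiffOn ht.1.le
  have h3 := h1.eq_of_eqOn h2 ht.1.le ht.2 h
  rw [map_add, map_add] at h3
  have h4 : D.mulVec (A.mulVec (x t)) = D.mulVec (A.mulVec (x' t)) := add_right_cancel h3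
  simpa only [Matrix.mulVec_mulVec] using h4

lemma observableOn_of_kalman {n m s k : ℕ} {α T : ℝ} (hα : α ≤ k) (hT : 0 < T)
    {A : Matrix (Fin n) (Fin n) ℝ} {B : Matrix (Fin n) (Fin m) ℝ} {C : Matrix (Fin s) (Fin n) ℝ}
    (hK : ∀ z : Fin n → ℝ, (∀ l, (C * A ^ l).mulVec z = 0) → z = 0) :
    ObservableOn α k A B C T := by
  intro u hu x x' hx hx' hC j _
  have hl (l : ℕ) : EqOn (fun t => (C * A ^ l).mulVec (x t))
      (fun t => (C * A ^ l).mulVec (x' t)) (Icc 0 T) := by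
    induction l with
    | zero =>
      rw [pow_zero, Matrix.mul_one]
      exact hC
    | succ l ih =>
      rw [pow_succ, ← Matrix.mul_assoc]
      exact eqOn_mul_mulVec_of_eqOn hα hT hu hx hx' ih
  refine initialValue_congr hT (fun t ht => sub_eq_zero.1 (hK _ fun l => ?_)) j
  rw [Matrix.mulVec_sub]
  exact sub_eq_zero.2 (hl l ht)

/-! ### Growth of the Gamma function and Euler's beta integral -/

/-- `Γ(x + 1) ≥ R ^ x e ^ (-R)`, obtained by restricting Euler's integral to `(R, ∞)`. It shows
that `1 / Γ` decays faster than any geometric sequence. -/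
lemma rpow_div_Gamma_le {R x : ℝ} (hR : 0 < R) (hx : 0 ≤ x) :
    R ^ x / Real.Gamma (x + 1) ≤ Real.exp R := by
  have hG : 0 < Real.Gamma (x + 1) := Real.Gamma_pos_of_pos (by linarith)
  have hint : IntegrableOn (fun s : ℝ => Real.exp (-s) * s ^ x) (Ioi 0) := by
    simpa using Real.GammaIntegral_convergent (s := x + 1) (by linarith)
  have h1 : R ^ x * Real.exp (-R) ≤ Real.Gamma (x + 1) := by
    rw [Real.Gamma_eq_integral (by linarith), ← integral_exp_neg_Ioi R, ← integral_const_mul]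
    simp only [add_sub_cancel_right]
    refine le_trans ?_ (setIntegral_mono_set hint ?_ (Ioi_subset_Ioi hR.le).eventuallyLE)
    · refine setIntegral_mono_on ((integrableOn_exp_neg_Ioi R).const_mul _)
        (hint.mono_set (Ioi_subset_Ioi hR.le)) measurableSet_Ioi fun s hs => ?_
      rw [mul_comm]
      gcongr
      exact hs.le
    · filter_upwards [ae_restrict_mem measurableSet_Ioi] with s hs
      have : (0 : ℝ) ≤ s := le_of_lt hs
      change 0 ≤ Real.exp (-s) * s ^ x
      positivity
  rw [div_le_iff₀ hG]
  calc R ^ x = Real.exp R * (R ^ x * Real.exp (-R)) := by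
        rw [mul_left_comm, ← Real.exp_add]; simp
    _ ≤ _ := by gcongr

lemma summable_pow_mul_rpow_div_Gamma {α b M T : ℝ} (hα : 0 < α) (hb : 0 ≤ b) (hM : 0 ≤ M)
    (hT : 0 ≤ T) :
    Summable fun l : ℕ => M ^ l * (T ^ (α * l + b) / Real.Gamma (α * l + b + 1)) := by
  -- `R` is chosen so that the comparison series has ratio `M T ^ α / R ^ α < 1`.
  set Q : ℝ := M * T ^ α + 1 with hQ
  have hMT : 0 ≤ M * T ^ α := by positivity
  have hQ0 : 0 < Q := by positivity
  set R : ℝ := Q ^ α⁻¹ with hR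
  have hR0 : 0 < R := by positivity
  have hRα : R ^ α = Q := Real.rpow_inv_rpow hQ0.le hα.ne'
  have hgeo : Summable fun l : ℕ => Real.exp R * (T ^ b / R ^ b) * (M * T ^ α / Q) ^ l :=
    (summable_geometric_of_lt_one (by positivity)
      ((div_lt_one hQ0).2 (by linarith))).mul_left _
  refine hgeo.of_nonneg_of_le (fun l => ?_) fun l => ?_
  · have : 0 < Real.Gamma (α * l + b + 1) := Real.Gamma_pos_of_pos (by positivity)
    positivity
  · have hx : 0 ≤ α * l + b := by positivity
    have h1 := rpow_div_Gamma_le hR0 hx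
    have h2 {y : ℝ} (hy : 0 ≤ y) : y ^ (α * l + b) = (y ^ α) ^ l * y ^ b := by
      rw [Real.rpow_add_of_nonneg hy (by positivity) hb, Real.rpow_mul hy, Real.rpow_natCast]
    have h3 : M ^ l * (T ^ (α * l + b) / Real.Gamma (α * l + b + 1)) =
        (R ^ (α * l + b) / Real.Gamma (α * l + b + 1)) *
          ((T ^ b / R ^ b) * (M * T ^ α / Q) ^ l) := by
      rw [h2 hT, h2 hR0.le, hRα, div_pow, mul_pow]
      field_simp
    rw [h3, mul_assoc]
    gcongr

/-- The Riemann–Liouville integral of order `β` of the normalized power `τ ^ b / Γ(b + 1)`, up to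
the factor `Γ(β)`. -/
lemma integral_rpow_sub_mul_rpow_div_Gamma {β b t : ℝ} (hβ : 0 < β) (hb : 0 ≤ b) (ht : 0 ≤ t) :
    ∫ τ in (0 : ℝ)..t, (t - τ) ^ (β - 1) * (τ ^ b / Real.Gamma (b + 1)) =
      Real.Gamma β * (t ^ (b + β) / Real.Gamma (b + β + 1)) := by
  rcases ht.eq_or_lt with rfl | ht
  · simp [Real.zero_rpow (by linarith : b + β ≠ 0)]
  have h1 := Complex.betaIntegral_scaled ((b + 1 : ℝ) : ℂ) (β : ℂ) ht
  have h2 := Complex.Gamma_mul_Gamma_eq_betaIntegral (s := ((b + 1 : ℝ) : ℂ)) (t := (β : ℂ))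
    (by simp only [Complex.ofReal_re]; linarith) (by simpa using hβ)
  have h3 : ∫ x in (0 : ℝ)..t, (x : ℂ) ^ (((b + 1 : ℝ) : ℂ) - 1) * ((t : ℂ) - x) ^ ((β : ℂ) - 1) =
      ((∫ x in (0 : ℝ)..t, x ^ b * (t - x) ^ (β - 1) : ℝ) : ℂ) := by
    rw [← intervalIntegral.integral_ofReal]
    refine intervalIntegral.integral_congr fun x hx => ?_
    rw [uIcc_of_le ht.le] at hx
    push_cast
    rw [Complex.ofReal_cpow hx.1, Complex.ofReal_cpow (sub_nonneg.2 hx.2)]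
    push_cast
    ring_nf
  have hG1 : 0 < Real.Gamma (b + 1) := Real.Gamma_pos_of_pos (by linarith)
  have hG2 : 0 < Real.Gamma (b + β + 1) := Real.Gamma_pos_of_pos (by linarith)
  have hG2' : (Real.Gamma (b + β + 1) : ℂ) ≠ 0 := by exact_mod_cast hG2.ne'
  have h4 : ((∫ x in (0 : ℝ)..t, x ^ b * (t - x) ^ (β - 1) : ℝ) : ℂ) =
      ((t ^ (b + β) * (Real.Gamma (b + 1) * Real.Gamma β / Real.Gamma (b + β + 1)) : ℝ) : ℂ) := by
    rw [← h3, h1]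
    have h5 : ((b + 1 : ℝ) : ℂ) + β = ((b + β + 1 : ℝ) : ℂ) := by push_cast; ring
    rw [h5, Complex.Gamma_ofReal, Complex.Gamma_ofReal, Complex.Gamma_ofReal] at h2
    rw [h5]
    push_cast
    rw [h2, mul_div_cancel_left₀ _ hG2', Complex.ofReal_cpow ht.le]
    push_cast
    ring_nf
  have h6 := Complex.ofReal_injective h4
  calc _ = (Real.Gamma (b + 1))⁻¹ * ∫ x in (0 : ℝ)..t, x ^ b * (t - x) ^ (β - 1) := by
        rw [← intervalIntegral.integral_const_mul]
        congr 1
        ext x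
        ring
    _ = _ := by
        rw [h6]
        field_simp

/-! ### Mittag-Leffler functions of an operator -/

section MittagLeffler

variable {E : Type*} [NormedAddCommGroup E] [NormedSpace ℝ E]

/-- The two-parameter Mittag-Leffler type function
`t ↦ ∑ l, t ^ (α l + b) / Γ(α l + b + 1) • L ^ l v`. The factor `t ^ b` is kept inside the series,
so that fractional integration only shifts `b`. -/
noncomputable def mittagLeffler (α b : ℝ) (L : E →L[ℝ] E) (v : E) (t : ℝ) : E :=
  ∑' l : ℕ, (t ^ (α * l + b) / Real.Gamma (α * l + b + 1)) • (L ^ l) v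

variable {α b T t β : ℝ} (L : E →L[ℝ] E) (v : E)

lemma norm_mittagLeffler_term_le (hα : 0 < α) (hb : 0 ≤ b) (ht : t ∈ Icc 0 T) (l : ℕ) :
    ‖(t ^ (α * l + b) / Real.Gamma (α * l + b + 1)) • (L ^ l) v‖ ≤
      ‖L‖ ^ l * (T ^ (α * l + b) / Real.Gamma (α * l + b + 1)) * ‖v‖ := by
  have hG : 0 < Real.Gamma (α * l + b + 1) := Real.Gamma_pos_of_pos (by positivity)
  have h0 := ht.1
  rw [norm_smul, Real.norm_of_nonneg (by positivity)]
  have h1 : ‖(L ^ l) v‖ ≤ ‖L‖ ^ l * ‖v‖ := by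
    induction l with
    | zero => simp
    | succ l ih =>
      rw [pow_succ', pow_succ', mul_assoc]
      exact (L.le_opNorm _).trans (by gcongr; exact ih (Real.Gamma_pos_of_pos (by positivity)))
  calc _ ≤ T ^ (α * l + b) / Real.Gamma (α * l + b + 1) * (‖L‖ ^ l * ‖v‖) := by
        have := ht.2
        have := h0.trans this
        gcongr
    _ = _ := by ring

lemma summable_mittagLeffler_bound (hα : 0 < α) (hb : 0 ≤ b) (hT : 0 ≤ T) :
    Summable fun l : ℕ =>
      ‖L‖ ^ l * (T ^ (α * l + b) / Real.Gamma (α * l + b + 1)) * ‖v‖ :=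
  (summable_pow_mul_rpow_div_Gamma hα hb (norm_nonneg L) hT).mul_right _

lemma hasSum_mittagLeffler [CompleteSpace E] (hα : 0 < α) (hb : 0 ≤ b) (ht : 0 ≤ t) :
    HasSum (fun l : ℕ => (t ^ (α * l + b) / Real.Gamma (α * l + b + 1)) • (L ^ l) v)
      (mittagLeffler α b L v t) :=
  (Summable.of_norm_bounded (summable_mittagLeffler_bound L v hα hb ht)
    (norm_mittagLeffler_term_le L v hα hb ⟨ht, le_rfl⟩)).hasSum

lemma continuousOn_mittagLeffler [CompleteSpace E] (hα : 0 < α) (hb : 0 ≤ b) :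
    ContinuousOn (mittagLeffler α b L v) (Ici 0) := by
  have h (T : ℝ) (hT : 0 ≤ T) : ContinuousOn (mittagLeffler α b L v) (Icc 0 T) := by
    refine continuousOn_tsum (fun l => ?_) (summable_mittagLeffler_bound L v hα hb hT)
      fun l t ht => norm_mittagLeffler_term_le L v hα hb ht l
    have : Continuous fun t : ℝ => t ^ (α * l + b) :=
      Real.continuous_rpow_const (by positivity)
    fun_prop
  intro t ht
  refine (h (t + 1) (add_nonneg ht zero_le_one) t ⟨ht, by linarith⟩).mono_of_mem_nhdsWithin ?_
  filter_upwards [self_mem_nhdsWithin, mem_nhdsWithin_of_mem_nhds (Iio_mem_nhds (lt_add_one t))]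
    with τ h0 h1
  exact ⟨h0, h1.le⟩

lemma mittagLeffler_zero_right (hα : 0 < α) (hb : 0 < b) : mittagLeffler α b L v 0 = 0 := by
  refine (tsum_congr fun l => ?_).trans tsum_zero
  rw [Real.zero_rpow (by positivity), zero_div, zero_smul]

/-- The leading term of the series. -/
lemma mittagLeffler_eq_add [CompleteSpace E] (hα : 0 < α) (hb : 0 ≤ b) (ht : 0 ≤ t) :
    mittagLeffler α b L v t =
      (t ^ b / Real.Gamma (b + 1)) • v + mittagLeffler α (α + b) L (L v) t := by
  rw [mittagLeffler, (hasSum_mittagLeffler L v hα hb ht).summable.tsum_eq_zero_add,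
    mittagLeffler]
  congr 1
  · simp
  · refine tsum_congr fun l => ?_
    rw [pow_succ]
    push_cast
    rw [show α * (l + 1) + b = α * l + (α + b) by ring]
    rfl

/-- Fractional integration of order `β` raises the parameter `b` by `β`. -/
lemma rlIntegral_mittagLeffler [CompleteSpace E] (hα : 0 < α) (hb : 0 ≤ b) (hβ : 0 ≤ β)
    (ht : 0 ≤ t) :
    rlIntegral β (mittagLeffler α b L v) t = mittagLeffler α (b + β) L v t := by
  unfold rlIntegral
  split_ifs with h0
  · rw [h0, add_zero]
  replace hβ : 0 < β := hβ.lt_of_ne' h0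
  have hG : 0 < Real.Gamma β := Real.Gamma_pos_of_pos hβ
  have hker : IntervalIntegrable (fun τ : ℝ => (t - τ) ^ (β - 1)) volume 0 t :=
    intervalIntegrable_rpow_sub hβ
  set bd : ℕ → ℝ := fun l =>
    ‖L‖ ^ l * (t ^ (α * l + b) / Real.Gamma (α * l + b + 1)) * ‖v‖ with hbd
  have hbds : Summable bd := summable_mittagLeffler_bound L v hα hb ht
  have key := intervalIntegral.hasSum_integral_of_dominated_convergence (μ := volume)
    (a := 0) (b := t)
    (F := fun (l : ℕ) τ => (t - τ) ^ (β - 1) •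
      ((τ ^ (α * l + b) / Real.Gamma (α * l + b + 1)) • (L ^ l) v))
    (f := fun τ => (t - τ) ^ (β - 1) • mittagLeffler α b L v τ)
    (fun l τ => (t - τ) ^ (β - 1) * bd l) (fun l => ?_) (fun l => ?_) ?_ ?_ ?_
  · have h1 : ∀ l : ℕ, ∫ τ in (0 : ℝ)..t, (t - τ) ^ (β - 1) •
        ((τ ^ (α * l + b) / Real.Gamma (α * l + b + 1)) • (L ^ l) v) =
        Real.Gamma β • ((t ^ (α * l + (b + β)) / Real.Gamma (α * l + (b + β) + 1)) •
          (L ^ l) v) := by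
      intro l
      simp_rw [smul_smul]
      rw [intervalIntegral.integral_smul_const, integral_rpow_sub_mul_rpow_div_Gamma hβ
        (by positivity) ht, add_assoc (α * (l : ℝ)) b β]
    simp_rw [h1] at key
    rw [key.unique ((hasSum_mittagLeffler L v hα (by positivity) ht).const_smul _),
      inv_smul_smul₀ hG.ne']
  · refine AEStronglyMeasurable.smul ?_ ?_
    · rw [uIoc_of_le ht]
      exact ((intervalIntegrable_iff_integrableOn_Ioc_of_le ht).1 hker).aestronglyMeasurable
    · have : Continuous fun t : ℝ => t ^ (α * l + b) :=
        Real.continuous_rpow_const (by positivity)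
      exact Continuous.aestronglyMeasurable (by fun_prop)
  · refine Eventually.of_forall fun τ hτ => ?_
    rw [uIoc_of_le ht] at hτ
    have h2 : 0 ≤ (t - τ) ^ (β - 1) := Real.rpow_nonneg (sub_nonneg.2 hτ.2) _
    rw [norm_smul, Real.norm_of_nonneg h2]
    exact mul_le_mul_of_nonneg_left
      (norm_mittagLeffler_term_le L v hα hb ⟨hτ.1.le, hτ.2⟩ l) h2
  · exact Eventually.of_forall fun τ _ => hbds.mul_left _
  · simp_rw [tsum_mul_left]
    exact hker.mul_const _
  · refine Eventually.of_forall fun τ hτ => ?_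
    rw [uIoc_of_le ht] at hτ
    exact (hasSum_mittagLeffler L v hα hb hτ.1.le).const_smul _

/-- The derivative lowers `b` by one; this is the fundamental theorem of calculus applied to the
case `β = 1` of `rlIntegral_mittagLeffler`. -/
lemma hasDerivWithinAt_mittagLeffler [CompleteSpace E] (hα : 0 < α) (hb : 0 ≤ b) (ht : 0 ≤ t) :
    HasDerivWithinAt (mittagLeffler α (b + 1) L v) (mittagLeffler α b L v t) (Ici 0) t := by
  -- The integrand is extended continuously to the left of `0`, so that the two-sided theorem
  -- applies also at the end point `0`.
  set f : ℝ → E := fun τ => mittagLeffler α b L v (max τ 0) with hf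
  have hfc : Continuous f := (continuousOn_mittagLeffler L v hα hb).comp_continuous
    (by fun_prop) fun τ => mem_Ici.2 (le_max_right τ 0)
  have h1 := (hfc.integral_hasStrictDerivAt 0 t).hasDerivAt.hasDerivWithinAt (s := Ici 0)
  have h2 : EqOn (mittagLeffler α (b + 1) L v) (fun τ => ∫ x in (0 : ℝ)..τ, f x) (Ici 0) := by
    intro τ hτ
    rw [← rlIntegral_mittagLeffler L v hα hb zero_le_one hτ, rlIntegral]
    simp only [one_ne_zero, if_false, Real.Gamma_one, inv_one, one_smul, sub_self,
      Real.rpow_zero]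
    refine intervalIntegral.integral_congr fun x hx => ?_
    rw [uIcc_of_le hτ] at hx
    simp only [hf, max_eq_left hx.1]
  have h3 : f t = mittagLeffler α b L v t := by simp only [hf, max_eq_left ht]
  rw [h3] at h1
  exact h1.congr h2 (h2 ht)

end MittagLeffler

/-! ### Iterated derivatives on the half-line -/

section Chain

variable {E : Type*} [NormedAddCommGroup E] [NormedSpace ℝ E] {G : ℕ → ℝ → E} {N : ℕ}

lemma iteratedDerivWithin_eqOn_of_chain
    (hG : ∀ i < N, ∀ t, 0 ≤ t → HasDerivWithinAt (G i) (G (i + 1) t) (Ici 0) t) {i : ℕ}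
    (hi : i ≤ N) : EqOn (iteratedDerivWithin i (G 0) (Ici 0)) (G i) (Ici 0) := by
  induction i with
  | zero => intro t _; simp
  | succ i ih =>
    intro t ht
    rw [iteratedDerivWithin_succ,
      derivWithin_congr (ih (Nat.le_of_succ_le hi)) (ih (Nat.le_of_succ_le hi) ht)]
    exact (hG i hi t ht).derivWithin (uniqueDiffOn_Ici 0 t ht)

lemma contDiffOn_of_chain
    (hG : ∀ i < N, ∀ t, 0 ≤ t → HasDerivWithinAt (G i) (G (i + 1) t) (Ici 0) t)
    (hN : ContinuousOn (G N) (Ici 0)) : ContDiffOn ℝ (N : WithTop ℕ∞) (G 0) (Ici 0) := by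
  have hd : ∀ i < N, DifferentiableOn ℝ (iteratedDerivWithin i (G 0) (Ici 0)) (Ici 0) :=
    fun i hi => DifferentiableOn.congr (fun t ht => (hG i hi t ht).differentiableWithinAt)
      (iteratedDerivWithin_eqOn_of_chain hG hi.le)
  refine (contDiffOn_nat_iff_continuousOn_differentiableOn_deriv (uniqueDiffOn_Ici 0)).2
    ⟨fun i hi => ?_, hd⟩
  rcases hi.eq_or_lt with rfl | hi
  · exact hN.congr (iteratedDerivWithin_eqOn_of_chain hG le_rfl)
  · exact (hd i hi).continuousOn

end Chain

/-! ### Trajectories of the uncontrolled system -/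

section FreeState

variable {E : Type*} [NormedAddCommGroup E] [NormedSpace ℝ E]

lemma rlIntegral_finset_sum {ι : Type*} (S : Finset ι) {β t : ℝ} (hβ : 0 ≤ β) (ht : 0 ≤ t)
    {f : ι → ℝ → E} (hf : ∀ i ∈ S, ContinuousOn (f i) (Ici 0)) :
    rlIntegral β (fun τ => ∑ i ∈ S, f i τ) t = ∑ i ∈ S, rlIntegral β (f i) t := by
  unfold rlIntegral
  split_ifs with h
  · rfl
  · simp_rw [Finset.smul_sum]
    rw [intervalIntegral.integral_finsetSum fun i hi =>
      intervalIntegrable_rpow_sub_smul (hβ.lt_of_ne' h) ht (hf i hi), Finset.smul_sum]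

/-- The solution `∑ j < k, ∑ l, t ^ (α l + j) / Γ(α l + j + 1) • L ^ l (v j)` of the uncontrolled
Caputo equation `D^α x = L x` with initial values `x^(j)(0) = v j`. -/
noncomputable def freeState (α : ℝ) (k : ℕ) (L : E →L[ℝ] E) (v : ℕ → E) (t : ℝ) : E :=
  ∑ j ∈ Finset.range k, mittagLeffler α j L (v j) t

/-- The candidate for the `i`-th derivative of `freeState α k L v`, `i < k`: the Taylor polynomial
at `0` is split off, so that the remaining series have exponents bounded below by `α - i > 0`. -/
noncomputable def freeStateDeriv (α : ℝ) (k : ℕ) (L : E →L[ℝ] E) (v : ℕ → E) (i : ℕ) (t : ℝ) : E :=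
  ∑ j ∈ Finset.range k, ((if i ≤ j then t ^ (j - i) / ((j - i).factorial : ℝ) else 0) • v j +
    mittagLeffler α (α + j - i) L (L (v j)) t)

variable {α t : ℝ} {k : ℕ} (L : E →L[ℝ] E) (v : ℕ → E)

lemma map_mittagLeffler [CompleteSpace E] {b : ℝ} (hα : 0 < α) (hb : 0 ≤ b) (ht : 0 ≤ t)
    (w : E) : L (mittagLeffler α b L w t) = mittagLeffler α b L (L w) t := by
  have h := (hasSum_mittagLeffler L w hα hb ht).mapL L
  refine h.unique ((hasSum_mittagLeffler L (L w) hα hb ht).congr_fun ?_)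
  intro l
  rw [L.map_smul, ← ContinuousLinearMap.comp_apply, ← ContinuousLinearMap.comp_apply]
  congr 2
  exact ((Commute.refl L).pow_right l)

lemma freeState_eqOn_freeStateDeriv_zero [CompleteSpace E] (hα : 0 < α) :
    EqOn (freeState α k L v) (freeStateDeriv α k L v 0) (Ici 0) := by
  intro t ht
  refine Finset.sum_congr rfl fun j _ => ?_
  rw [mittagLeffler_eq_add L (v j) hα j.cast_nonneg ht, Real.rpow_natCast,
    Real.Gamma_nat_eq_factorial]
  simp

lemma hasDerivAt_pow_div_factorial (i j : ℕ) (t : ℝ) :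
    HasDerivAt (fun t : ℝ => if i ≤ j then t ^ (j - i) / ((j - i).factorial : ℝ) else 0)
      (if i + 1 ≤ j then t ^ (j - (i + 1)) / ((j - (i + 1)).factorial : ℝ) else 0) t := by
  rcases lt_trichotomy i j with h | rfl | h
  · obtain ⟨d, rfl⟩ := Nat.exists_eq_add_of_lt h
    have h1 : i + d + 1 - i = d + 1 := by omega
    have h2 : i + d + 1 - (i + 1) = d := by omega
    simp only [h.le, Nat.succ_le_of_lt h, if_true, h1, h2]
    have := (hasDerivAt_pow (d + 1) t).div_const ((d + 1).factorial : ℝ)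
    have h3 : t ^ d / (d.factorial : ℝ) =
        ((d + 1 : ℕ) : ℝ) * t ^ (d + 1 - 1) / ((d + 1).factorial : ℝ) := by
      rw [Nat.factorial_succ, Nat.add_sub_cancel]
      push_cast
      have : (d.factorial : ℝ) ≠ 0 := by exact_mod_cast d.factorial_ne_zero
      field_simp
    rwa [h3]
  · simpa using! hasDerivAt_const t (1 : ℝ)
  · simp only [h.not_ge, (Nat.lt_succ_of_lt h).not_ge, if_false]
    exact hasDerivAt_const t 0

lemma hasDerivWithinAt_freeStateDeriv [CompleteSpace E] (hα : (k : ℝ) - 1 < α) (hα0 : 0 < α)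
    (i : ℕ) (hi : i < k - 1) (t : ℝ) (ht : 0 ≤ t) :
    HasDerivWithinAt (freeStateDeriv α k L v i) (freeStateDeriv α k L v (i + 1) t) (Ici 0) t := by
  have hi' : (i : ℝ) + 2 ≤ k := by exact_mod_cast (by omega : i + 2 ≤ k)
  refine HasDerivWithinAt.fun_sum fun j _ => ?_
  have hj : (0 : ℝ) ≤ j := j.cast_nonneg
  refine ((hasDerivAt_pow_div_factorial i j t).hasDerivWithinAt.smul_const _).add ?_
  have := hasDerivWithinAt_mittagLeffler L (L (v j)) hα0
    (b := α + j - (i + 1 : ℕ)) (by push_cast; linarith) ht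
  rwa [show α + j - (i + 1 : ℕ) + 1 = α + j - i by push_cast; ring] at this

lemma natCast_lt_of_lt (hα : (k : ℝ) - 1 < α) {i : ℕ} (hi : i < k) : (i : ℝ) < α := by
  have : (i : ℝ) + 1 ≤ k := by exact_mod_cast hi
  linarith

lemma contDiffOn_freeState [CompleteSpace E] (hk : 1 ≤ k) (hα : (k : ℝ) - 1 < α) (hα0 : 0 < α) :
    ContDiffOn ℝ ((k - 1 : ℕ) : WithTop ℕ∞) (freeState α k L v) (Ici 0) := by
  refine (contDiffOn_of_chain (hasDerivWithinAt_freeStateDeriv L v hα hα0) ?_).congr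
    (freeState_eqOn_freeStateDeriv_zero L v hα0)
  refine continuousOn_finsetSum _ fun j _ => ContinuousOn.add ?_ ?_
  · refine ContinuousOn.smul ?_ continuousOn_const
    split_ifs
    · exact Continuous.continuousOn (by fun_prop)
    · exact continuousOn_const
  · have h1 := natCast_lt_of_lt hα (i := k - 1) (by omega)
    have hj : (0 : ℝ) ≤ j := j.cast_nonneg
    exact continuousOn_mittagLeffler L _ hα0 (by linarith)

lemma initialValue_freeState [CompleteSpace E] (hα : (k : ℝ) - 1 < α) (hα0 : 0 < α) {i : ℕ}
    (hi : i < k) : initialValue (freeState α k L v) i = v i := by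
  have h0 : (0 : ℝ) ∈ Ici (0 : ℝ) := self_mem_Ici
  rw [initialValue, iteratedDerivWithin_congr (freeState_eqOn_freeStateDeriv_zero L v hα0) h0,
    iteratedDerivWithin_eqOn_of_chain (hasDerivWithinAt_freeStateDeriv L v hα hα0)
      (Nat.le_sub_one_of_lt hi) h0, freeStateDeriv, Finset.sum_eq_single_of_mem i
      (Finset.mem_range.2 hi)]
  · have h1 := natCast_lt_of_lt hα hi
    rw [mittagLeffler_zero_right L _ hα0 (by linarith)]
    simp
  · intro j _ hji
    have h1 := natCast_lt_of_lt hα hi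
    have hj : (0 : ℝ) ≤ j := j.cast_nonneg
    rw [mittagLeffler_zero_right L _ hα0 (by linarith), add_zero]
    split_ifs with h
    · rw [zero_pow (by omega), zero_div, zero_smul]
    · rw [zero_smul]

lemma caputoPrimitive_freeState [CompleteSpace E] (hα : (k : ℝ) - 1 < α) (hα0 : 0 < α)
    (hαk : α ≤ k) :
    EqOn (caputoPrimitive α k (freeState α k L v))
      (fun t => ∑ j ∈ Finset.range k, mittagLeffler α (k + j) L (L (v j)) t) (Ici 0) := by
  intro t ht
  have hw : EqOn (fun t => freeState α k L v t - ∑ j ∈ Finset.range k,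
      (t ^ j / (j.factorial : ℝ)) • initialValue (freeState α k L v) j)
      (fun t => ∑ j ∈ Finset.range k, mittagLeffler α (α + j) L (L (v j)) t) (Icc 0 t) := by
    intro τ hτ
    simp only
    rw [freeState_eqOn_freeStateDeriv_zero L v hα0 hτ.1, freeStateDeriv, ← Finset.sum_sub_distrib]
    refine Finset.sum_congr rfl fun j hj => ?_
    rw [initialValue_freeState L v hα hα0 (Finset.mem_range.1 hj)]
    simp
  rw [caputoPrimitive, rlIntegral_congr hw ⟨ht, le_rfl⟩,
    rlIntegral_finset_sum _ (sub_nonneg.2 hαk) ht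
      fun j _ => continuousOn_mittagLeffler L _ hα0 (by positivity)]
  refine Finset.sum_congr rfl fun j _ => ?_
  rw [rlIntegral_mittagLeffler L _ hα0 (by positivity) (sub_nonneg.2 hαk) ht]
  congr 1
  ring

lemma hasCaputoDerivAt_freeState [CompleteSpace E] (hk : 1 ≤ k) (hα : (k : ℝ) - 1 < α)
    (hα0 : 0 < α) (hαk : α ≤ k) (ht : 0 ≤ t) :
    HasCaputoDerivAt α k (freeState α k L v) (L (freeState α k L v t)) t := by
  let H : ℕ → ℝ → E := fun i t =>
    ∑ j ∈ Finset.range k, mittagLeffler α (k + j - i) L (L (v j)) t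
  have hH : ∀ i < k, ∀ t, 0 ≤ t → HasDerivWithinAt (H i) (H (i + 1) t) (Ici 0) t := by
    intro i hi t ht
    have hi' : (i : ℝ) + 1 ≤ k := by exact_mod_cast hi
    refine HasDerivWithinAt.fun_sum fun j _ => ?_
    have hj : (0 : ℝ) ≤ j := j.cast_nonneg
    have := hasDerivWithinAt_mittagLeffler L (L (v j)) hα0
      (b := k + j - (i + 1 : ℕ)) (by push_cast; linarith) ht
    rwa [show (k : ℝ) + j - (i + 1 : ℕ) + 1 = k + j - i by push_cast; ring] at this
  have hH' : ∀ i < k - 1, ∀ t, 0 ≤ t → HasDerivWithinAt (H i) (H (i + 1) t) (Ici 0) t :=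
    fun i hi => hH i (by omega)
  have hp : EqOn (caputoPrimitive α k (freeState α k L v)) (H 0) (Ici 0) := by
    intro τ hτ
    rw [caputoPrimitive_freeState L v hα hα0 hαk hτ]
    simp [H]
  have hd : EqOn (iteratedDerivWithin (k - 1) (caputoPrimitive α k (freeState α k L v)) (Ici 0))
      (H (k - 1)) (Ici 0) := fun τ hτ =>
    (iteratedDerivWithin_congr hp hτ).trans (iteratedDerivWithin_eqOn_of_chain hH' le_rfl hτ)
  refine ⟨(contDiffOn_of_chain hH' fun τ hτ =>
    (hH (k - 1) (by omega) τ hτ).continuousWithinAt).congr hp, ?_⟩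
  have hlast := (hH (k - 1) (by omega) t ht).congr hd (hd ht)
  have hval : H (k - 1 + 1) t = L (freeState α k L v t) := by
    rw [freeState, map_sum, Nat.sub_add_cancel hk]
    refine Finset.sum_congr rfl fun j _ => ?_
    rw [map_mittagLeffler L hα0 j.cast_nonneg ht, add_sub_cancel_left]
  rwa [hval] at hlast

end FreeState

lemma isAdmissibleControl_zero {m : ℕ} : IsAdmissibleControl (fun _ => (0 : Fin m → ℝ)) where
  bounded := ⟨0, fun _ _ => by simp⟩
  finite_discontinuities T := by
    convert Set.finite_empty
    ext t
    simpa using fun _ _ => continuousWithinAt_const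
  left_limit _ _ := ⟨0, tendsto_const_nhds⟩
  right_limit _ _ := ⟨0, tendsto_const_nhds⟩

/-- The continuous linear map of a matrix. -/
noncomputable def mulVecCLM {n s : ℕ} (A : Matrix (Fin s) (Fin n) ℝ) :
    (Fin n → ℝ) →L[ℝ] (Fin s → ℝ) :=
  LinearMap.toContinuousLinearMap A.mulVecLin

lemma mulVecCLM_apply {n s : ℕ} (A : Matrix (Fin s) (Fin n) ℝ) (z : Fin n → ℝ) :
    mulVecCLM A z = A.mulVec z := rfl

lemma mulVecCLM_pow_apply {n : ℕ} (A : Matrix (Fin n) (Fin n) ℝ) (l : ℕ) (z : Fin n → ℝ) :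
    (mulVecCLM A ^ l) z = (A ^ l).mulVec z := by
  induction l generalizing z with
  | zero => simp
  | succ l ih =>
    rw [pow_succ, pow_succ, ← Matrix.mulVec_mulVec, ← ih]
    rfl

lemma isTrajectory_freeState {n m k : ℕ} {α : ℝ} (hk : 1 ≤ k) (hα : (k : ℝ) - 1 < α)
    (hα0 : 0 < α) (hαk : α ≤ k) (A : Matrix (Fin n) (Fin n) ℝ) (B : Matrix (Fin n) (Fin m) ℝ)
    (v : ℕ → Fin n → ℝ) :
    IsTrajectory α k A B (fun _ => 0) (freeState α k (mulVecCLM A) v) where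
  contDiffOn := contDiffOn_freeState _ v hk hα hα0
  equation t ht _ := by
    rw [Matrix.mulVec_zero, add_zero]
    exact hasCaputoDerivAt_freeState _ v hk hα hα0 hαk ht

/-- Observability forbids a nonzero free state with zero output. -/
lemma ObservableOn.eq_zero_of_freeState {n m s k : ℕ} {α T : ℝ} (hk : 1 ≤ k)
    (hα : (k : ℝ) - 1 < α) (hα0 : 0 < α) (hαk : α ≤ k) {A : Matrix (Fin n) (Fin n) ℝ}
    {B : Matrix (Fin n) (Fin m) ℝ} {C : Matrix (Fin s) (Fin n) ℝ}
    (h : ObservableOn α k A B C T) {v : ℕ → Fin n → ℝ}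
    (hv : ∀ t ∈ Icc 0 T, C.mulVec (freeState α k (mulVecCLM A) v t) = 0) {j : ℕ} (hj : j < k) :
    v j = 0 := by
  have h1 := h _ isAdmissibleControl_zero _ _ (isTrajectory_freeState hk hα hα0 hαk A B v)
    (isTrajectory_freeState hk hα hα0 hαk A B 0) (fun t ht => by
      rw [hv t ht]
      simp [freeState, mittagLeffler]) j hj
  rwa [initialValue_freeState _ v hα hα0 hj, initialValue_freeState _ 0 hα hα0 hj] at h1

/-! ### The observability Gramian -/

section Gramian

variable {n s k : ℕ} {α t T : ℝ} (A : Matrix (Fin n) (Fin n) ℝ) (C : Matrix (Fin s) (Fin n) ℝ)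

lemma summable_Phi (hα : 0 < α) (j : ℕ) (ht : 0 ≤ t) :
    Summable fun l : ℕ =>
      (t ^ (α * (l : ℝ)) / Real.Gamma (α * (l : ℝ) + (j : ℝ) + 1)) • A ^ l := by
  -- For `T ≥ 1`, the terms are dominated by those of a Mittag-Leffler series at `T`.
  set T : ℝ := max t 1 with hT
  have hT1 : 1 ≤ T := le_max_right _ _
  have hT0 : 0 ≤ T := zero_le_one.trans hT1
  have hv (w : Fin n → ℝ) : Summable fun l : ℕ =>
      (t ^ (α * (l : ℝ)) / Real.Gamma (α * (l : ℝ) + (j : ℝ) + 1)) • (A ^ l).mulVec w := by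
    refine Summable.of_norm_bounded
      (summable_mittagLeffler_bound (mulVecCLM A) w hα j.cast_nonneg hT0) fun l => ?_
    refine le_trans ?_ (norm_mittagLeffler_term_le (mulVecCLM A) w hα j.cast_nonneg
      ⟨hT0, le_rfl⟩ l)
    have hG : 0 < Real.Gamma (α * l + j + 1) := Real.Gamma_pos_of_pos (by positivity)
    rw [mulVecCLM_pow_apply, norm_smul, norm_smul, Real.norm_of_nonneg (by positivity),
      Real.norm_of_nonneg (by positivity)]
    gcongr
    exact (Real.rpow_le_rpow ht (le_max_left _ _) (by positivity)).trans
      (Real.rpow_le_rpow_of_exponent_le hT1 (by linarith [j.cast_nonneg (α := ℝ)]))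
  refine Pi.summable.2 fun r => Pi.summable.2 fun q => ?_
  have := Pi.summable.1 (hv (Pi.single q 1)) r
  simpa using! this

/-- The blocks of `Ψ` act as Mittag-Leffler functions of `A`. -/
lemma smul_Phi_mulVec (hα : 0 < α) (j : ℕ) (ht : 0 ≤ t) (w : Fin n → ℝ) :
    (t ^ j • Phi α A j t).mulVec w = mittagLeffler α j (mulVecCLM A) w t := by
  have h1 := (summable_Phi A hα j ht).hasSum.map (Matrix.mulVec.addMonoidHomLeft w)
    (Continuous.matrix_mulVec continuous_id continuous_const)
  have h2 := h1.const_smul (t ^ j)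
  rw [Matrix.smul_mulVec]
  refine h2.unique ((hasSum_mittagLeffler (mulVecCLM A) w hα j.cast_nonneg ht).congr_fun ?_)
  intro l
  rw [mulVecCLM_pow_apply, Real.rpow_add_of_nonneg ht (by positivity) j.cast_nonneg,
    Real.rpow_natCast]
  change t ^ j • ((_ : ℝ) • A ^ l).mulVec w = _
  rw [Matrix.smul_mulVec, smul_smul]
  congr 1
  ring

lemma Psi_mulVec (hα : 0 < α) (ht : 0 ≤ t) (v : ℕ → Fin n → ℝ) :
    (Psi α k A t).mulVec (fun p => v p.1 p.2) = freeState α k (mulVecCLM A) v t := by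
  ext i
  rw [freeState, Finset.sum_range, Finset.sum_apply, Matrix.mulVec, dotProduct,
    Fintype.sum_prod_type]
  refine Finset.sum_congr rfl fun j _ => ?_
  rw [← smul_Phi_mulVec A hα j ht]
  rfl

lemma continuousOn_Psi (hα : 0 < α) (i : Fin n) (p : Fin k × Fin n) :
    ContinuousOn (fun t => Psi α k A t i p) (Ici 0) := by
  have h := (continuous_apply i).comp_continuousOn (continuousOn_mittagLeffler (mulVecCLM A)
    (Pi.single p.2 1) hα (b := (p.1 : ℕ)) (Nat.cast_nonneg _))
  refine h.congr fun t ht => ?_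
  simp only [Function.comp_apply]
  rw [← smul_Phi_mulVec A hα p.1 ht, Matrix.mulVec_single_one]
  rfl

/-- The quadratic form of the Gramian is the energy of the output of a free state. -/
lemma dotProduct_obsGramian_mulVec (hα : 0 < α) (hT : 0 ≤ T) (c : Fin k × Fin n → ℝ) :
    c ⬝ᵥ (obsGramian α k A C T).mulVec c =
      ∫ τ in (0 : ℝ)..T, C.mulVec ((Psi α k A τ).mulVec c) ⬝ᵥ
        C.mulVec ((Psi α k A τ).mulVec c) := by
  have hint (p q : Fin k × Fin n) : IntervalIntegrable (fun τ =>
      ((Psi α k A τ).transpose * C.transpose * C * Psi α k A τ) p q) volume 0 T := by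
    refine ContinuousOn.intervalIntegrable ?_
    rw [uIcc_of_le hT]
    simp only [Matrix.mul_apply, Matrix.transpose_apply]
    have h (i p) :=
      (continuousOn_Psi (k := k) A hα i p).mono (Icc_subset_Ici_self : Icc 0 T ⊆ Ici 0)
    fun_prop
  have hpt (τ : ℝ) : C.mulVec ((Psi α k A τ).mulVec c) ⬝ᵥ C.mulVec ((Psi α k A τ).mulVec c) =
      ∑ p, ∑ q, c p * (((Psi α k A τ).transpose * C.transpose * C * Psi α k A τ) p q * c q) := by
    simp_rw [← Finset.mul_sum]
    change _ = c ⬝ᵥ Matrix.mulVec _ c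
    rw [Matrix.mul_assoc, ← Matrix.transpose_mul, ← Matrix.mulVec_mulVec, Matrix.mulVec_transpose,
      dotProduct_comm c, ← Matrix.dotProduct_mulVec, Matrix.mulVec_mulVec]
  have hsum (p : Fin k × Fin n) : IntervalIntegrable (fun τ => ∑ q, c p *
      (((Psi α k A τ).transpose * C.transpose * C * Psi α k A τ) p q * c q)) volume 0 T := by
    simpa only [Finset.sum_fn] using IntervalIntegrable.sum Finset.univ fun q _ =>
      ((hint p q).mul_const (c q)).const_mul (c p)
  rw [intervalIntegral.integral_congr fun τ _ => hpt τ,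
    intervalIntegral.integral_finsetSum fun p _ => hsum p]
  refine Finset.sum_congr rfl fun p _ => ?_
  rw [intervalIntegral.integral_finsetSum fun q _ => ((hint p q).mul_const _).const_mul _,
    Matrix.mulVec, dotProduct, Finset.mul_sum]
  refine Finset.sum_congr rfl fun q _ => ?_
  rw [intervalIntegral.integral_const_mul, intervalIntegral.integral_mul_const]
  rfl

lemma isHermitian_obsGramian : (obsGramian α k A C T).IsHermitian := by
  ext p q
  rw [Matrix.conjTranspose_apply, star_trivial]
  refine intervalIntegral.integral_congr fun τ _ => ?_
  have h : ((Psi α k A τ).transpose * C.transpose * C * Psi α k A τ).transpose =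
      (Psi α k A τ).transpose * C.transpose * C * Psi α k A τ := by
    simp only [Matrix.transpose_mul, Matrix.transpose_transpose, Matrix.mul_assoc]
  exact congrFun (congrFun h p) q

variable {A C}

lemma posDef_obsGramian_of_observableOn {m : ℕ} {B : Matrix (Fin n) (Fin m) ℝ} (hk : 1 ≤ k)
    (hα : (k : ℝ) - 1 < α) (hα0 : 0 < α) (hαk : α ≤ k) (hT : 0 < T)
    (h : ObservableOn α k A B C T) : (obsGramian α k A C T).PosDef := by
  refine Matrix.PosDef.of_dotProduct_mulVec_pos (isHermitian_obsGramian A C) fun c hc => ?_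
  rw [star_trivial, dotProduct_obsGramian_mulVec A C hα0 hT.le]
  have hcont : ContinuousOn (fun τ => C.mulVec ((Psi α k A τ).mulVec c) ⬝ᵥ
      C.mulVec ((Psi α k A τ).mulVec c)) (Icc 0 T) := by
    have h (i p) :=
      (continuousOn_Psi (k := k) A hα0 i p).mono (Icc_subset_Ici_self : Icc 0 T ⊆ Ici 0)
    simp only [Matrix.mulVec, dotProduct]
    fun_prop
  have hnn (y : Fin s → ℝ) : 0 ≤ y ⬝ᵥ y := Finset.sum_nonneg fun i _ => mul_self_nonneg (y i)
  refine intervalIntegral.integral_pos hT hcont (fun _ _ => hnn _) ?_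
  by_contra! hle
  set v : ℕ → Fin n → ℝ := fun j i => if hj : j < k then c (⟨j, hj⟩, i) else 0 with hv
  have hcv : c = fun p => v p.1 p.2 := by
    ext p
    simp [hv]
  refine hc ?_
  have hz : ∀ t ∈ Icc 0 T, C.mulVec (freeState α k (mulVecCLM A) v t) = 0 := by
    intro t ht
    rw [← Psi_mulVec A hα0 ht.1, ← hcv]
    exact dotProduct_self_eq_zero.1 ((hle t ht).antisymm (hnn _))
  rw [hcv]
  ext p
  exact congrFun (h.eq_zero_of_freeState hk hα hα0 hαk hz p.1.2) p.2

lemma kalman_of_posDef_obsGramian (hk : 1 ≤ k) (hα : 0 < α) (hT : 0 ≤ T)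
    (h : (obsGramian α k A C T).PosDef) (z : Fin n → ℝ)
    (hz : ∀ l, (C * A ^ l).mulVec z = 0) : z = 0 := by
  by_contra hz0
  -- The free state with `x(0) = z` and all other initial values `0` has zero output.
  set v : ℕ → Fin n → ℝ := fun j => if j = 0 then z else 0 with hv
  have hc : (fun p : Fin k × Fin n => v p.1 p.2) ≠ 0 := fun h0 =>
    hz0 (funext fun i => by simpa [hv] using congrFun h0 (⟨0, hk⟩, i))
  have hpos := h.dotProduct_mulVec_pos hc
  rw [star_trivial, dotProduct_obsGramian_mulVec A C hα hT] at hpos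
  refine hpos.ne' ((intervalIntegral.integral_congr (g := fun _ => 0) fun τ hτ => ?_).trans
    intervalIntegral.integral_zero)
  rw [uIcc_of_le hT] at hτ
  have hvl (j l : ℕ) : C.mulVec ((A ^ l).mulVec (v j)) = 0 := by
    simp only [hv]
    split_ifs
    · rw [Matrix.mulVec_mulVec, hz]
    · simp
  have h0 : C.mulVec (freeState α k (mulVecCLM A) v τ) = 0 := by
    rw [← mulVecCLM_apply, freeState, map_sum]
    refine Finset.sum_eq_zero fun j _ => ?_
    refine ((hasSum_mittagLeffler (mulVecCLM A) (v j) hα j.cast_nonneg hτ.1).mapL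
      (mulVecCLM C)).unique (hasSum_zero.congr_fun fun l => ?_)
    rw [map_smul, mulVecCLM_pow_apply, mulVecCLM_apply, hvl, smul_zero]
  simp only
  rw [Psi_mulVec A hα hτ.1, h0, dotProduct_zero]

end Gramian

end FractionalSystem

theorem corollary4p5 {n m s : ℕ} (k : ℕ) (hk : 1 ≤ k) (α : ℝ)
    (hα₁ : (k : ℝ) - 1 < α) (hα₂ : α ≤ (k : ℝ))
    (A : Matrix (Fin n) (Fin n) ℝ) (B : Matrix (Fin n) (Fin m) ℝ)
    (C : Matrix (Fin s) (Fin n) ℝ) :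
    List.TFAE [
      FractionalSystem.Observable α k A B C,
      ∀ T : ℝ, 0 < T → FractionalSystem.ObservableOn α k A B C T,
      (FractionalSystem.obsMatrix A C).rank = n,
      ∀ lam ∈ spectrum ℂ (A.map Complex.ofReal), (FractionalSystem.pbhMatrix A C lam).rank = n,
      ∀ T : ℝ, 0 < T → (FractionalSystem.obsGramian α k A C T).PosDef,
      ∃ T : ℝ, 0 < T ∧ (FractionalSystem.obsGramian α k A C T).PosDef] := by
  have hα0 : 0 < α := by
    have : (1 : ℝ) ≤ k := by exact_mod_cast hk
    linarith
  tfae_have 3 ↔ 4 := FractionalSystem.obsMatrix_rank_iff_pbhMatrix_rank A C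
  tfae_have 3 → 2 := fun h T hT =>
    FractionalSystem.observableOn_of_kalman hα₂ hT ((FractionalSystem.obsMatrix_rank_iff A C).1 h)
  tfae_have 2 → 1 := fun h => ⟨1, one_pos, h 1 one_pos⟩
  tfae_have 2 → 5 := fun h T hT =>
    FractionalSystem.posDef_obsGramian_of_observableOn hk hα₁ hα0 hα₂ hT (h T hT)
  tfae_have 5 → 6 := fun h => ⟨1, one_pos, h 1 one_pos⟩
  tfae_have 1 → 6 := fun ⟨T, hT, h⟩ =>
    ⟨T, hT, FractionalSystem.posDef_obsGramian_of_observableOn hk hα₁ hα0 hα₂ hT h⟩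
  tfae_have 6 → 3 := fun ⟨T, hT, h⟩ => (FractionalSystem.obsMatrix_rank_iff A C).2
    (FractionalSystem.kalman_of_posDef_obsGramian hk hα0 hT.le h)
  tfae_finish
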